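/- Conventions. Let $X$ be a compact Hausdorff space and $T\colon X\to X$ a continuous map. Let $H_1\subset\mathbb{C}$ be the set of eigenvalues of $T$, i.e. of those $\lambda\in\mathbb{C}$ with $f\circ T=\lambda f$ for some $f\in C(X)$, $f\neq0$. Put $G_0=H_1$ (numbers regarded as constant functions), and for $n\ge 0$ let $G_{n+1}$ be the set of all $f\in C(X)$ with $|f|\equiv 1$ such that $f\circ T=g f$ for some $g\in G_n$. The pair $(X,T)$ has quasi-discrete spectrum if the algebra generated by $\bigcup_{n\ge1}G_n$ is dense in $C(X)$; its order $d_T\in\{1,2,\dots\}\cup\{\infty\}$ is then the least integer $d\ge 1$ with $G_d=G_{d+1}$, and $d_T=\infty$ if there is no such integer. For $0\le D\le\infty$, a complex sequence $(c_n)_{n\ge0}$ is oscillating of order $D$ if $\lim_{N\to\infty}\frac1N\sum_{n=0}^{N-1}c_ne^{2\pi iP(n)}=0$ for every real polynomial $P$ of degree at most $D$ (for every real polynomial $P$ if $D=\infty$). We put $\infty\cdot 0=0$. Statement. Let $X$ be a connected compact (Hausdorff) abelian group, and let $T\colon X\to X$ be a minimal affine transformation, that is, $Tx=Ax+a$ with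 a continuous endomorphism $A$ of $X$ and $a\in X$, such that every forward orbit $\{T^nx:n\ge0\}$ is dense in $X$. Then $(X,T)$ has quasi-discrete spectrum of some order $d_T$, $1\le d_T\le\infty$. Moreover, let $\ell\ge1$, let $q_1,\dots,q_\ell\in\mathbb{Q}[z]$ be polynomials with $q_j(n)\in\mathbb{N}=\{0,1,2,\dots\}$ for all integers $n\ge0$, let $\Delta=\max_{1\le j\le\ell}\deg q_j$ (the zero polynomial being given degree $0$), and let $(c_n)_{n\ge0}$ be a complex sequence that is oscillating of order $d_T\Delta$ and satisfies $\sum_{n=1}^N|c_n|=O(N)$. Then for every continuous function $F\in C(X^\ell)$ and every point $x\in X$, $$\lim_{N\to\infty}\frac1N\sum_{n=0}^{N-1}c_n\,F\bigl(T^{q_1(n)}x,\dots,T^{q_\ell(n)}x\bigr)=0 .$$ -/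

import Mathlib

open Filter Topology

noncomputable section

namespace QuasiDiscrete

/-- A self-map of a topological space is minimal if every forward orbit
`{T^n x : n ≥ 0}` is dense. -/
def IsMinimalMap {X : Type*} [TopologicalSpace X] (T : C(X, X)) : Prop :=
  ∀ x : X, Dense (Set.range fun n : ℕ => T^[n] x)

/-- An affine transformation of a topological abelian group (written additively): a continuous
endomorphism followed by a translation. -/
def IsAffineMap {X : Type*} [TopologicalSpace X] [AddCommGroup X] (T : C(X, X)) : Prop :=
  ∃ (A : X →ₜ+ X) (a : X), ∀ x : X, T x = A x + a

/-- The eigenvalues of `f ↦ f ∘ T` on `C(X, ℂ)`: the set `H₁`. -/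
def eigenvalues {X : Type*} [TopologicalSpace X] (T : C(X, X)) : Set ℂ :=
  {z | ∃ f : C(X, ℂ), f ≠ 0 ∧ f.comp T = z • f}

/-- The sets `G_n` of quasi-eigenfunctions. `G_0 = H₁`, its elements regarded as constant
functions; `G_{n+1}` consists of the continuous `f` of modulus one everywhere such that
`f ∘ T = g f` for some `g ∈ G_n`. So `G_1` is the set of eigenfunctions of modulus one. -/
def quasiEigenfunctions {X : Type*} [TopologicalSpace X] (T : C(X, X)) : ℕ → Set C(X, ℂ)
  | 0 => {g | ∃ z ∈ eigenvalues T, g = ContinuousMap.const X z}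
  | n + 1 => {f | (∀ x, ‖f x‖ = 1) ∧ ∃ g ∈ quasiEigenfunctions T n, f.comp T = g * f}

/-- `(X, T)` has quasi-discrete spectrum: the algebra generated by the quasi-eigenfunctions
`⋃_{n ≥ 1} G_n` is dense in `C(X, ℂ)`. -/
def HasQuasiDiscreteSpectrum {X : Type*} [TopologicalSpace X] (T : C(X, X)) : Prop :=
  Dense (Algebra.adjoin ℂ (⋃ n : ℕ, quasiEigenfunctions T (n + 1)) : Set C(X, ℂ))

/-- `(X, T)` has quasi-discrete spectrum of order `d`, `1 ≤ d ≤ ∞`: `d` is the least integer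
`n ≥ 1` with `G_n = G_{n+1}`, and `d = ∞` if there is no such integer. -/
def HasQuasiDiscreteSpectrumOfOrder {X : Type*} [TopologicalSpace X] (T : C(X, X)) (d : ℕ∞) :
    Prop :=
  HasQuasiDiscreteSpectrum T ∧
    d = sInf {m : ℕ∞ | ∃ n : ℕ, 1 ≤ n ∧
      quasiEigenfunctions T n = quasiEigenfunctions T (n + 1) ∧ m = (n : ℕ∞)}

/-- `c` is oscillating of order `D`: for each real polynomial `P` of degree at most `D`,
the means of `c_n e^{2πi P(n)}` tend to `0`. For `D = ∞` the sequence is fully oscillating. -/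
def IsOscillating (c : ℕ → ℂ) (D : ℕ∞) : Prop :=
  ∀ P : Polynomial ℝ, (P.natDegree : ℕ∞) ≤ D →
    Tendsto (fun N : ℕ => (1 / (N : ℂ)) * ∑ n ∈ Finset.range N,
        c n * Complex.exp (2 * (Real.pi : ℂ) * Complex.I * ((P.eval (n : ℝ) : ℝ) : ℂ)))
      atTop (𝓝 0)

end QuasiDiscrete

end

/-! Characters of $X^\ell$ span a dense subspace of $C(X^\ell)$, and the bound on $\sum|c_n|$ makes
the averages stable under uniform approximation. So it suffices to treat a product of characters of
$X$, one per coordinate, and to show that along an orbit each is $e^{2\pi iP(n)}$ with $\deg P\le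
d_T$. Composing with the $q_j$ then gives a single phase of degree at most $d_T\Delta$, and
oscillation applies.

The key point is that $A^*-1$ is locally nilpotent on the character group. By a Fitting argument,
some $(A^*-1)^k\gamma$ lies in an invariant subgroup $S$ on which $A^*-1$ is injective. Duality then
gives a point $x$ with $s(Tx)=s(x)$ for all $s\in S$; these $s$ are constant on the orbit of $x$, so
$S=0$ by minimality. Nilpotence makes every character a quasi-eigenfunction, and iterated summation
makes its phase polynomial. The rank can be lowered to $d_T$ because the chain $G_n$ is constant
once two consecutive terms agree.

Separation of points by characters is itself proved here, by Gelfand theory applied to translations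
and a convolution operator on $L^2$. -/

section CompactGroups

open MeasureTheory

/-! ### Characters from commutative C*-algebras -/

/-- A character of the closed star subalgebra generated by a commuting star-closed set which does
not vanish at a prescribed nonzero element of the algebra. -/
theorem CStarAlgebra.exists_starHom_adjoin_ne_zero {B : Type*} [CStarAlgebra B] (S : Set B)
    (hstar : ∀ a ∈ S, star a ∈ S) (hcomm : ∀ a ∈ S, ∀ b ∈ S, a * b = b * a)
    {u : B} (hu : u ∈ StarAlgebra.adjoin ℂ S) (hu0 : u ≠ 0) :
    ∃ φ : StarAlgebra.adjoin ℂ S →⋆ₐ[ℂ] ℂ, Continuous φ ∧ φ ⟨u, hu⟩ ≠ 0 := by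
  set A := StarAlgebra.adjoin ℂ S
  have hA : IsMulCommutative A := StarAlgebra.isMulCommutative_adjoin ℂ hcomm
    (fun a ha b hb => hcomm a ha _ (hstar b hb))
  let R : CommRing A.topologicalClosure := A.commRingTopologicalClosure mul_comm'
  have : IsClosed (A.topologicalClosure : Set B) := isClosed_closure
  let _ : CommCStarAlgebra A.topologicalClosure :=
    { (inferInstance : CStarAlgebra A.topologicalClosure) with
      mul_comm := R.mul_comm }
  have hle : A ≤ A.topologicalClosure := A.le_topologicalClosure
  -- The Gelfand transform of a commutative C*-algebra is isometric, so a nonzero element has a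
  -- nonzero value at some character.
  have hne : WeakDual.gelfandTransform ℂ A.topologicalClosure ⟨u, hle hu⟩ ≠ 0 := by
    intro h
    rw [← map_zero (WeakDual.gelfandTransform ℂ A.topologicalClosure)] at h
    have := (gelfandTransform_isometry A.topologicalClosure).injective h
    exact hu0 (congrArg Subtype.val this)
  obtain ⟨φ, hφ⟩ : ∃ φ, WeakDual.gelfandTransform ℂ A.topologicalClosure ⟨u, hle hu⟩ φ ≠ 0 := by
    by_contra! h
    exact hne (ContinuousMap.ext h)
  refine ⟨((StarAlgHomClass.toStarAlgHom φ : A.topologicalClosure →⋆ₐ[ℂ] ℂ)).comp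
    (StarSubalgebra.inclusion hle), ?_, hφ⟩
  exact (map_continuous φ).comp (continuous_inclusion hle)

/-- If a unitary representation `U` of `X` commutes with a self-adjoint `K` and `y ↦ U y * K` is
norm continuous, then `U x * K ≠ K` is detected by a character of `X`. -/
theorem exists_character_ne_zero_of_representation {X : Type*} [TopologicalSpace X]
    [AddCommGroup X] [IsTopologicalAddGroup X] {B : Type*} [CStarAlgebra B]
    (U : X → B) (hzero : U 0 = 1) (hadd : ∀ x y, U (x + y) = U x * U y)
    (hstar : ∀ x, star (U x) = U (-x)) (K : B) (hK : star K = K)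
    (hcomm : ∀ x, U x * K = K * U x) (hcont : Continuous fun y => U y * K)
    {x : X} (hx : U x * K ≠ K) : ∃ χ : X →ₜ+ UnitAddCircle, χ x ≠ 0 := by
  set S : Set B := insert K (Set.range U)
  have hS1 : ∀ a ∈ S, star a ∈ S := by
    rintro a (rfl | ⟨y, rfl⟩)
    · rw [hK]; exact Set.mem_insert _ _
    · rw [hstar]; exact Set.mem_insert_of_mem _ ⟨_, rfl⟩
  have hS2 : ∀ a ∈ S, ∀ b ∈ S, a * b = b * a := by
    rintro a (rfl | ⟨y, rfl⟩) b (rfl | ⟨z, rfl⟩)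
    · rfl
    · exact (hcomm z).symm
    · exact hcomm y
    · rw [← hadd, ← hadd, add_comm]
  have hUm : ∀ y, U y ∈ StarAlgebra.adjoin ℂ S := fun y =>
    StarAlgebra.subset_adjoin ℂ S (Set.mem_insert_of_mem _ ⟨y, rfl⟩)
  have hKm : K ∈ StarAlgebra.adjoin ℂ S := StarAlgebra.subset_adjoin ℂ S (Set.mem_insert _ _)
  have hum : U x * K - K ∈ StarAlgebra.adjoin ℂ S := sub_mem (mul_mem (hUm x) hKm) hKm
  obtain ⟨φ, hφc, hφ⟩ := CStarAlgebra.exists_starHom_adjoin_ne_zero S hS1 hS2 hum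
    (sub_ne_zero.mpr hx)
  set ψ : X → ℂ := fun y => φ ⟨U y, hUm y⟩ with hψ
  have hψ0 : ψ 0 = 1 := by
    have : (⟨U 0, hUm 0⟩ : StarAlgebra.adjoin ℂ S) = 1 := Subtype.ext hzero
    simp only [hψ, this, map_one]
  have hψadd : ∀ y z, ψ (y + z) = ψ y * ψ z := fun y z => by
    have : (⟨U (y + z), hUm _⟩ : StarAlgebra.adjoin ℂ S) = ⟨U y, hUm y⟩ * ⟨U z, hUm z⟩ :=
      Subtype.ext (hadd y z)
    simp only [hψ, this, map_mul]
  have hψstar : ∀ y, star (ψ y) = ψ (-y) := fun y => by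
    have : (⟨U (-y), hUm _⟩ : StarAlgebra.adjoin ℂ S) = star ⟨U y, hUm y⟩ :=
      Subtype.ext (hstar y).symm
    simp only [hψ, this, map_star]
  have hnorm : ∀ y, ‖ψ y‖ = 1 := fun y => by
    have h1 : ψ y * star (ψ y) = 1 := by rw [hψstar, ← hψadd, add_neg_cancel, hψ0]
    have h2 : ‖ψ y‖ * ‖ψ y‖ = 1 := by simpa using congrArg norm h1
    nlinarith [norm_nonneg (ψ y)]
  have hmul : (⟨U x * K - K, hum⟩ : StarAlgebra.adjoin ℂ S)
      = ⟨U x, hUm x⟩ * ⟨K, hKm⟩ - ⟨K, hKm⟩ := rfl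
  -- Both factors matter: the first gives nontriviality at `x`, the second permits division by `φ K`
  -- below.
  have hφ' : (ψ x - 1) * φ ⟨K, hKm⟩ ≠ 0 := by
    rw [hmul, map_sub, map_mul] at hφ
    rwa [sub_mul, one_mul]
  have hK0 : φ ⟨K, hKm⟩ ≠ 0 := right_ne_zero_of_mul hφ'
  have hψx : ψ x ≠ 1 := sub_ne_zero.mp (left_ne_zero_of_mul hφ')
  -- `U` need not be norm continuous; only `U y * K` is, and `ψ y` is its value under `φ` divided by
  -- `φ K`.
  have hψc : Continuous ψ := by
    have h1 : Continuous fun y => φ ⟨U y * K, mul_mem (hUm y) hKm⟩ :=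
      hφc.comp (hcont.subtype_mk _)
    have h2 : ψ = fun y => φ ⟨U y * K, mul_mem (hUm y) hKm⟩ / φ ⟨K, hKm⟩ := by
      funext y
      have : (⟨U y * K, mul_mem (hUm y) hKm⟩ : StarAlgebra.adjoin ℂ S)
        = ⟨U y, hUm y⟩ * ⟨K, hKm⟩ := rfl
      rw [this, map_mul, mul_div_cancel_right₀ _ hK0]
    rw [h2]
    exact h1.div_const _
  let c : X → Circle := fun y => ⟨ψ y, by simpa [Submonoid.unitSphere] using hnorm y⟩
  have hc : Continuous c := hψc.subtype_mk _
  let e := AddCircle.homeomorphCircle (T := (1 : ℝ)) one_ne_zero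
  have he : ∀ y, AddCircle.toCircle (e.symm (c y)) = c y := fun y => by
    rw [← AddCircle.homeomorphCircle_apply one_ne_zero]; exact e.apply_symm_apply _
  have hinj := AddCircle.injective_toCircle (T := (1 : ℝ)) one_ne_zero
  refine ⟨⟨⟨⟨fun y => e.symm (c y), ?_⟩, ?_⟩, e.symm.continuous.comp hc⟩, ?_⟩
  · apply hinj
    rw [he, AddCircle.toCircle_zero]
    exact Subtype.ext hψ0
  · intro y z
    apply hinj
    rw [AddCircle.toCircle_add, he, he, he]
    exact Subtype.ext (hψadd y z)
  · intro h
    have h' : e.symm (c x) = 0 := h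
    have := he x
    rw [h', AddCircle.toCircle_zero] at this
    exact hψx (congrArg Subtype.val this).symm

/-! ### Translations and convolution operators on $L^2$ -/

section Convolution

variable {X : Type*} [TopologicalSpace X] [CompactSpace X] [MeasurableSpace X] [BorelSpace X]

/-- The map `L²(μ) → C(X)` with continuous kernel `κ : X → L²(μ)`. -/
noncomputable def kernelMap (μ : Measure X) (κ : C(X, Lp ℂ 2 μ)) : Lp ℂ 2 μ →L[ℂ] C(X, ℂ) :=
  LinearMap.mkContinuous
    ({ toFun := fun h => ⟨fun x => inner ℂ (κ x) h, by fun_prop⟩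
       map_add' := fun h k => by ext x; simp [inner_add_right]
       map_smul' := fun c h => by ext x; simp [inner_smul_right] } : Lp ℂ 2 μ →ₗ[ℂ] C(X, ℂ))
    ‖κ‖ (fun h => by
        rw [ContinuousMap.norm_le _ (by positivity)]
        intro x
        change ‖inner ℂ (κ x) h‖ ≤ _
        refine (norm_inner_le_norm _ _).trans ?_
        gcongr
        exact κ.norm_coe_le_norm x)

/-- The operator on `L²(μ)` with continuous kernel `κ : X → L²(μ)`. -/
noncomputable def kernelOperator (μ : Measure X) [IsFiniteMeasure μ]
    (κ : C(X, Lp ℂ 2 μ)) : Lp ℂ 2 μ →L[ℂ] Lp ℂ 2 μ :=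
  (ContinuousMap.toLp 2 μ ℂ : C(X, ℂ) →L[ℂ] Lp ℂ 2 μ).comp (kernelMap μ κ)

theorem kernelOperator_apply (μ : Measure X) [IsFiniteMeasure μ]
    (κ : C(X, Lp ℂ 2 μ)) (h : Lp ℂ 2 μ) :
    kernelOperator μ κ h =
      ContinuousMap.toLp 2 μ ℂ ⟨fun x => inner ℂ (κ x) h, by fun_prop⟩ := rfl

theorem kernelOperator_sub (μ : Measure X) [IsFiniteMeasure μ] (κ κ' : C(X, Lp ℂ 2 μ)) :
    kernelOperator μ (κ - κ') = kernelOperator μ κ - kernelOperator μ κ' := by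
  ext1 h
  rw [sub_apply]
  simp only [kernelOperator_apply]
  rw [← map_sub]
  congr 1
  ext x
  simp [inner_sub_left]

theorem norm_kernelOperator_le (μ : Measure X) [IsFiniteMeasure μ] (κ : C(X, Lp ℂ 2 μ)) :
    ‖kernelOperator μ κ‖ ≤ ‖(ContinuousMap.toLp 2 μ ℂ : C(X, ℂ) →L[ℂ] Lp ℂ 2 μ)‖ * ‖κ‖ := by
  refine (ContinuousLinearMap.opNorm_comp_le _ _).trans ?_
  gcongr
  exact LinearMap.mkContinuous_norm_le _ (norm_nonneg _) _

/-- Turns continuity of the translated kernel in `y` into norm continuity of `translation μ y * K`.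
-/
theorem continuous_kernelOperator (μ : Measure X) [IsFiniteMeasure μ] :
    Continuous (kernelOperator μ) := by
  have : LipschitzWith ‖(ContinuousMap.toLp 2 μ ℂ : C(X, ℂ) →L[ℂ] Lp ℂ 2 μ)‖₊
      (kernelOperator μ) := by
    refine LipschitzWith.of_dist_le_mul fun κ κ' => ?_
    rw [dist_eq_norm, dist_eq_norm, ← kernelOperator_sub]
    exact norm_kernelOperator_le μ _
  exact this.continuous

variable [AddCommGroup X] [IsTopologicalAddGroup X]

/-- Translation by `y` as an operator on `L²(μ)`. -/
noncomputable def translation (μ : Measure X) [μ.IsAddHaarMeasure] (y : X) :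
    Lp ℂ 2 μ →L[ℂ] Lp ℂ 2 μ :=
  (Lp.compMeasurePreservingₗᵢ ℂ (fun x => x + y)
    (measurePreserving_add_right μ y)).toContinuousLinearMap

theorem translation_toLp (μ : Measure X) [μ.IsAddHaarMeasure] (y : X) (f : C(X, ℂ)) :
    translation μ y (ContinuousMap.toLp 2 μ ℂ f) =
      ContinuousMap.toLp 2 μ ℂ (f.comp ⟨fun x => x + y, by fun_prop⟩) := rfl

theorem inner_translation_translation (μ : Measure X) [μ.IsAddHaarMeasure] (y : X)
    (f g : Lp ℂ 2 μ) : inner ℂ (translation μ y f) (translation μ y g) = inner ℂ f g :=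
  LinearIsometry.inner_map_map (Lp.compMeasurePreservingₗᵢ ℂ (fun x => x + y)
    (measurePreserving_add_right μ y)) f g

theorem ext_toLp {μ : Measure X} [IsFiniteMeasure μ] [T2Space X] [μ.WeaklyRegular]
    {S T : Lp ℂ 2 μ →L[ℂ] Lp ℂ 2 μ}
    (h : ∀ f : C(X, ℂ), S (ContinuousMap.toLp 2 μ ℂ f) = T (ContinuousMap.toLp 2 μ ℂ f)) :
    S = T := by
  have hd := ContinuousMap.toLp_denseRange ℂ μ ℂ (p := 2) (by simp)
  exact DFunLike.coe_injective (hd.equalizer S.continuous T.continuous (funext h))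

theorem translation_zero (μ : Measure X) [μ.IsAddHaarMeasure] [T2Space X] [μ.WeaklyRegular] :
    translation μ 0 = 1 := by
  refine ext_toLp fun f => ?_
  rw [translation_toLp, one_apply_eq_self]
  congr 1
  ext x
  simp

theorem translation_add (μ : Measure X) [μ.IsAddHaarMeasure] [T2Space X] [μ.WeaklyRegular]
    (y z : X) : translation μ (y + z) = translation μ y * translation μ z := by
  refine ext_toLp fun f => ?_
  rw [mul_apply_eq_comp]
  simp only [translation_toLp]
  congr 1
  ext x
  simp [add_assoc]

theorem star_translation (μ : Measure X) [μ.IsAddHaarMeasure] [T2Space X] [μ.WeaklyRegular]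
    (y : X) : star (translation μ y) = translation μ (-y) := by
  rw [ContinuousLinearMap.star_eq_adjoint]
  symm
  rw [ContinuousLinearMap.eq_adjoint_iff]
  intro f g
  rw [← inner_translation_translation μ y, ← mul_apply_eq_comp, ← translation_add,
    add_neg_cancel, translation_zero, one_apply_eq_self]

theorem translation_mul_kernelOperator (μ : Measure X) [μ.IsAddHaarMeasure]
    (κ : C(X, Lp ℂ 2 μ)) (y : X) :
    translation μ y * kernelOperator μ κ =
      kernelOperator μ (κ.comp ⟨fun x => x + y, by fun_prop⟩) := rfl

/-- Unitarity moves the translation onto the kernel. For an equivariant kernel the result is the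
operator obtained by translating on the left, so the two operators commute. -/
theorem kernelOperator_mul_translation (μ : Measure X) [μ.IsAddHaarMeasure] [T2Space X]
    [μ.WeaklyRegular] (κ : C(X, Lp ℂ 2 μ)) (y : X)
    (hκ : ∀ x, translation μ (-y) (κ x) = κ (x + y)) :
    kernelOperator μ κ * translation μ y =
      kernelOperator μ (κ.comp ⟨fun x => x + y, by fun_prop⟩) := by
  ext1 h
  rw [mul_apply_eq_comp, kernelOperator_apply, kernelOperator_apply]
  congr 1
  ext x
  simp only [ContinuousMap.coe_mk, ContinuousMap.comp_apply]
  rw [← hκ, ← inner_translation_translation μ y (translation μ (-y) (κ x)),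
    ← mul_apply_eq_comp, ← translation_add, add_neg_cancel, translation_zero,
    one_apply_eq_self]

/-- The kernel `x ↦ (y ↦ f (x - y))` of convolution by `f`. -/
noncomputable def convolutionKernel (μ : Measure X) [IsFiniteMeasure μ] (f : C(X, ℂ)) :
    C(X, Lp ℂ 2 μ) :=
  (⟨ContinuousMap.toLp 2 μ ℂ, (ContinuousMap.toLp 2 μ ℂ).continuous⟩ : C(C(X, ℂ), Lp ℂ 2 μ)).comp
    (ContinuousMap.curry (f.comp ⟨fun p : X × X => p.1 - p.2, by fun_prop⟩))

theorem convolutionKernel_apply (μ : Measure X) [IsFiniteMeasure μ] (f : C(X, ℂ)) (x : X) :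
    convolutionKernel μ f x =
      ContinuousMap.toLp 2 μ ℂ (f.comp ⟨fun y => x - y, by fun_prop⟩) := rfl

theorem inner_convolutionKernel (μ : Measure X) [IsFiniteMeasure μ] (f g : C(X, ℂ)) (x : X) :
    inner ℂ (convolutionKernel μ f x) (ContinuousMap.toLp 2 μ ℂ g) =
      ∫ y, g y * star (f (x - y)) ∂μ := by
  rw [convolutionKernel_apply, ContinuousMap.inner_toLp]
  rfl

theorem translation_convolutionKernel (μ : Measure X) [μ.IsAddHaarMeasure] (f : C(X, ℂ))
    (x y : X) : translation μ (-y) (convolutionKernel μ f x) = convolutionKernel μ f (x + y) := by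
  rw [convolutionKernel_apply, translation_toLp, convolutionKernel_apply]
  congr 1
  ext z
  simp only [ContinuousMap.comp_apply, ContinuousMap.coe_mk]
  congr 1
  abel

/-- The symmetry of `f` makes the kernel Hermitian; on the dense subspace of continuous functions,
self-adjointness is then Fubini. -/
theorem star_kernelOperator_convolutionKernel (μ : Measure X) [μ.IsAddHaarMeasure] [T2Space X]
    [μ.WeaklyRegular] (f : C(X, ℂ)) (hf : ∀ x, star (f x) = f (-x)) :
    star (kernelOperator μ (convolutionKernel μ f)) =
      kernelOperator μ (convolutionKernel μ f) := by
  have hd := ContinuousMap.toLp_denseRange ℂ μ ℂ (p := 2) (by simp)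
  rw [ContinuousLinearMap.star_eq_adjoint]
  symm
  rw [ContinuousLinearMap.eq_adjoint_iff]
  intro h k
  set K := kernelOperator μ (convolutionKernel μ f) with hK
  refine hd.induction_on₂ (p := fun h k => inner ℂ (K h) k = inner ℂ h (K k))
    (isClosed_eq (by fun_prop) (by fun_prop)) (fun h k => ?_) h k
  simp only [hK, kernelOperator_apply, inner_convolutionKernel, ContinuousMap.inner_toLp,
    ContinuousMap.coe_mk]
  have hint : ∀ x, k x * (starRingEnd ℂ) (∫ y, h y * star (f (x - y)) ∂μ) =
      ∫ y, k x * (star (h y) * f (x - y)) ∂μ := fun x => by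
    rw [← integral_conj, ← integral_const_mul]
    congr 1
    ext y
    simp
  have hint' : ∀ y, (∫ x, k x * star (f (y - x)) ∂μ) * (starRingEnd ℂ) (h y) =
      ∫ x, k x * (star (h y) * f (x - y)) ∂μ := fun y => by
    rw [← integral_mul_const]
    congr 1
    ext x
    rw [hf, neg_sub, starRingEnd_apply]
    ring
  simp only [hint, hint']
  exact integral_integral_swap_of_hasCompactSupport
    (f := fun x y => k x * (star (h y) * f (x - y))) (by simp only [Function.uncurry_def]; fun_prop)
    (HasCompactSupport.of_compactSpace _)

end Convolution

/-! ### Characters separate points and span a dense subspace -/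

/-- A continuous even bump function at `0` whose autocorrelation vanishes at `x`. -/
theorem exists_even_bump {X : Type*} [TopologicalSpace X] [AddCommGroup X]
    [IsTopologicalAddGroup X] [CompactSpace X] [T2Space X] {x : X} (hx : x ≠ 0) :
    ∃ f : C(X, ℝ), (∀ y, f (-y) = f y) ∧ f 0 ≠ 0 ∧ ∀ y, f (x - y) * f y = 0 := by
  have hV : ∀ᶠ p : X × X in 𝓝 (0, 0), p.1 - p.2 ≠ x := by
    have : ContinuousAt (fun p : X × X => p.1 - p.2) (0, 0) := by fun_prop
    exact this.eventually_ne (by simpa using hx.symm)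
  rw [nhds_prod_eq] at hV
  obtain ⟨p, hp, hpx⟩ := (eventually_prod_self_iff (r := fun a b => a - b ≠ x)).mp hV
  obtain ⟨V, hVp, hVo, hV0⟩ := mem_nhds_iff.mp hp
  obtain ⟨g, hg0, hg1, -⟩ := exists_continuous_zero_one_of_isClosed hVo.isClosed_compl
    (isClosed_singleton (x := (0 : X)))
    (Set.disjoint_singleton_right.mpr (by simpa using hV0))
  -- With the product, a nonzero value at a point puts both the point and its negative in `V`, so
  -- `x` would be a difference of two elements of `V`.
  refine ⟨g * g.comp ⟨fun y => -y, by fun_prop⟩, fun y => ?_, ?_, fun y => ?_⟩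
  · simp [mul_comm]
  · have : g 0 = 1 := hg1 rfl
    simp [this]
  · by_contra h
    simp only [ContinuousMap.mul_apply, ContinuousMap.comp_apply, ContinuousMap.coe_mk] at h
    have h1 : x - y ∈ V := by
      by_contra h'
      exact h (by rw [hg0 h']; simp)
    have h2 : -y ∈ V := by
      by_contra h'
      exact h (by rw [hg0 h']; simp)
    exact hpx _ (hVp h1) _ (hVp h2) (by abel)

/-- Convolution `K` by an even bump is self-adjoint and commutes with translations. Applying `U x *
K` and `K` to the bump and evaluating at `0` gives $0$ and $\int f^2>0$, so `U x * K ≠ K`. -/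
theorem exists_character_ne_zero {X : Type*} [TopologicalSpace X] [AddCommGroup X]
    [IsTopologicalAddGroup X] [CompactSpace X] [T2Space X] {x : X} (hx : x ≠ 0) :
    ∃ χ : X →ₜ+ UnitAddCircle, χ x ≠ 0 := by
  borelize X
  let μ : Measure X := Measure.addHaarMeasure ⊤
  obtain ⟨f, hfe, hf0, hfx⟩ := exists_even_bump hx
  let F : C(X, ℂ) := ⟨fun y => (f y : ℂ), by fun_prop⟩
  refine exists_character_ne_zero_of_representation (x := x) (translation μ)
    (translation_zero μ) (translation_add μ) (star_translation μ)
    (kernelOperator μ (convolutionKernel μ F))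
    (star_kernelOperator_convolutionKernel μ F fun y => by simp [F, hfe]) (fun y => ?_) ?_ ?_
  · rw [translation_mul_kernelOperator, kernelOperator_mul_translation]
    exact fun z => translation_convolutionKernel μ F z y
  · simp only [translation_mul_kernelOperator]
    refine (continuous_kernelOperator μ).comp ?_
    have : Continuous fun p : X × X => convolutionKernel μ F (p.2 + p.1) := by fun_prop
    exact (ContinuousMap.curry ⟨_, this⟩).continuous
  · intro h
    rw [translation_mul_kernelOperator] at h
    have h1 := DFunLike.congr_fun h (ContinuousMap.toLp 2 μ ℂ F)
    rw [kernelOperator_apply, kernelOperator_apply, ContinuousMap.toLp_inj] at h1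
    have h2 := DFunLike.congr_fun h1 0
    simp only [ContinuousMap.coe_mk, ContinuousMap.comp_apply, inner_convolutionKernel,
      zero_add, zero_sub] at h2
    have h3 : ∀ y, F y * star (F (x - y)) = 0 := fun y => by
      simp only [F, ContinuousMap.coe_mk]
      rw [Complex.star_def, Complex.conj_ofReal, ← Complex.ofReal_mul, mul_comm, hfx,
        Complex.ofReal_zero]
    have h4 : ∀ y, F y * star (F (-y)) = ((f y * f y : ℝ) : ℂ) := fun y => by
      simp only [F, ContinuousMap.coe_mk]
      rw [Complex.star_def, Complex.conj_ofReal, ← Complex.ofReal_mul, hfe]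
    simp only [h3, h4, integral_zero, integral_complex_ofReal] at h2
    have h5 : ∫ y, f y * f y ∂μ = 0 := by exact_mod_cast h2.symm
    have hc : Continuous fun y => f y * f y := by fun_prop
    have h6 := hc.integral_pos_of_hasCompactSupport_nonneg_nonzero (μ := μ)
      (HasCompactSupport.of_compactSpace _) (fun y => mul_self_nonneg _) (x := 0)
      (mul_self_ne_zero.mpr hf0)
    exact h6.ne' h5

/-- A character `γ : X → ℝ/ℤ`, as the continuous complex function `e^{2πiγ}`. -/
noncomputable def circleFun {X : Type*} [TopologicalSpace X] (γ : C(X, UnitAddCircle)) : C(X, ℂ) :=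
  ⟨fun x => (AddCircle.toCircle (γ x) : ℂ), by fun_prop⟩

theorem circleFun_apply {X : Type*} [TopologicalSpace X] (γ : C(X, UnitAddCircle)) (x : X) :
    circleFun γ x = (AddCircle.toCircle (γ x) : ℂ) := rfl

theorem norm_circleFun {X : Type*} [TopologicalSpace X] (γ : C(X, UnitAddCircle)) (x : X) :
    ‖circleFun γ x‖ = 1 :=
  Circle.norm_coe _

/-- The trigonometric polynomials are dense in `C(X)`. -/
theorem dense_span_circleFun (X : Type*) [TopologicalSpace X] [AddCommGroup X]
    [IsTopologicalAddGroup X] [CompactSpace X] [T2Space X] :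
    (Submodule.span ℂ (Set.range fun γ : X →ₜ+ UnitAddCircle =>
      circleFun (γ : C(X, UnitAddCircle)))).topologicalClosure = ⊤ := by
  -- Characters are closed under products and conjugation, so their span is already a star
  -- subalgebra and Stone–Weierstrass applies to it.
  let M : Submonoid C(X, ℂ) :=
    { carrier := Set.range fun γ : X →ₜ+ UnitAddCircle => circleFun (γ : C(X, UnitAddCircle))
      one_mem' := ⟨0, by ext x; simp [circleFun_apply]⟩
      mul_mem' := by
        rintro _ _ ⟨γ, rfl⟩ ⟨δ, rfl⟩
        exact ⟨γ + δ, by ext x; simp [circleFun_apply, AddCircle.toCircle_add]⟩ }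
  have hstar : ∀ f ∈ M, star f ∈ M := by
    rintro _ ⟨γ, rfl⟩
    refine ⟨-γ, ?_⟩
    ext x
    have : (-γ) x = -γ x := rfl
    simp [circleFun_apply, this, AddCircle.toCircle_neg, ← Circle.coe_inv_eq_conj]
  let S : StarSubalgebra ℂ C(X, ℂ) := StarAlgebra.adjoin ℂ (M : Set C(X, ℂ))
  have hM : star (M : Set C(X, ℂ)) = M := by
    ext f
    rw [Set.mem_star]
    exact ⟨fun h => star_star f ▸ hstar _ h, hstar f⟩
  have hS : S.toSubalgebra.toSubmodule = Submodule.span ℂ (M : Set C(X, ℂ)) := by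
    rw [StarAlgebra.adjoin_toSubalgebra, hM, Set.union_self, Algebra.adjoin_eq_span,
      Submonoid.closure_eq]
  have hsep : S.SeparatesPoints := by
    intro x y hxy
    obtain ⟨χ, hχ⟩ := exists_character_ne_zero (sub_ne_zero.mpr hxy)
    refine ⟨_, ⟨circleFun (χ : C(X, UnitAddCircle)),
      StarAlgebra.subset_adjoin ℂ _ ⟨χ, rfl⟩, rfl⟩, fun h => hχ ?_⟩
    rw [map_sub, sub_eq_zero]
    exact AddCircle.injective_toCircle one_ne_zero (Subtype.ext h)
  have hd := ContinuousMap.starSubalgebra_topologicalClosure_eq_top_of_separatesPoints S hsep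
  change (Submodule.span ℂ (M : Set C(X, ℂ))).topologicalClosure = ⊤
  rw [← hS, eq_top_iff]
  intro f _
  have : f ∈ S.topologicalClosure := hd ▸ trivial
  exact this

/-- Translating by a point `a` with `γ a ≠ 0` multiplies the integral by a number other than $1$. -/
theorem integral_circleFun_eq_zero {X : Type*} [TopologicalSpace X] [AddCommGroup X]
    [IsTopologicalAddGroup X] [MeasurableSpace X] [BorelSpace X]
    (μ : Measure X) [μ.IsAddHaarMeasure] (γ : X →ₜ+ UnitAddCircle) (hγ : γ ≠ 0) :
    ∫ x, circleFun (γ : C(X, UnitAddCircle)) x ∂μ = 0 := by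
  obtain ⟨a, ha⟩ : ∃ a, γ a ≠ 0 := by
    by_contra! h
    exact hγ (ContinuousAddMonoidHom.ext h)
  have h1 : ∀ x, circleFun (γ : C(X, UnitAddCircle)) (x + a) =
      circleFun (γ : C(X, UnitAddCircle)) x * (AddCircle.toCircle (γ a) : ℂ) := fun x => by
    simp [circleFun_apply, AddCircle.toCircle_add]
  have h2 := integral_add_right_eq_self (μ := μ) (circleFun (γ : C(X, UnitAddCircle))) a
  simp only [h1] at h2
  rw [integral_mul_const] at h2
  have h3 : (AddCircle.toCircle (γ a) : ℂ) - 1 ≠ 0 := by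
    rw [sub_ne_zero]
    intro h
    refine ha (AddCircle.injective_toCircle one_ne_zero ?_)
    rw [AddCircle.toCircle_zero]
    exact Subtype.ext h
  refine (mul_eq_zero.mp ?_).resolve_right h3
  rw [mul_sub, h2, mul_one, sub_self]

/-! ### Duality: prescribing values of characters -/

/-- Integration along a map out of a finite measure space, as a functional on `C(Y)`. -/
noncomputable def integralAlong {X Y : Type*} [TopologicalSpace X] [CompactSpace X]
    [MeasurableSpace X] [BorelSpace X] (μ : Measure X) [IsFiniteMeasure μ]
    [TopologicalSpace Y] [CompactSpace Y] (m : C(X, Y)) : C(Y, ℂ) →L[ℂ] ℂ :=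
  LinearMap.mkContinuous
    ({ toFun := fun g => ∫ x, g (m x) ∂μ
       map_add' := fun f g => by
        have h (f : C(Y, ℂ)) : Integrable (fun x => f (m x)) μ :=
          Continuous.integrable_of_hasCompactSupport (by fun_prop)
            (HasCompactSupport.of_compactSpace _)
        exact integral_add (h f) (h g)
       map_smul' := fun c g => integral_const_mul c _ } : C(Y, ℂ) →ₗ[ℂ] ℂ)
    (μ.real Set.univ) (fun g => by
      rw [mul_comm]
      exact norm_integral_le_of_norm_le_const (.of_forall fun x => g.norm_coe_le_norm _))

theorem integralAlong_apply {X Y : Type*} [TopologicalSpace X] [CompactSpace X]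
    [MeasurableSpace X] [BorelSpace X] (μ : Measure X) [IsFiniteMeasure μ]
    [TopologicalSpace Y] [CompactSpace Y] (m : C(X, Y)) (g : C(Y, ℂ)) :
    integralAlong μ m g = ∫ x, g (m x) ∂μ := rfl

theorem UnitAddTorus.mFourier_eq_toCircle {ι : Type*} [Fintype ι] (k : ι → ℤ)
    (z : UnitAddTorus ι) :
    UnitAddTorus.mFourier k z = (AddCircle.toCircle (∑ i, k i • z i) : ℂ) := by
  classical
  have h (s : Finset ι) : ∏ i ∈ s, fourier (k i) (z i) =
      (AddCircle.toCircle (∑ i ∈ s, k i • z i) : ℂ) := by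
    induction s using Finset.induction_on with
    | empty => simp
    | insert i s hi ih =>
      rw [Finset.prod_insert hi, Finset.sum_insert hi, AddCircle.toCircle_add, Circle.coe_mul,
        ← ih, fourier_apply]
  exact h Finset.univ

/-- Finite interpolation: characters `γ i` are matched at a point with values `a i` that satisfy
the integer relations holding between the characters. -/
theorem exists_forall_apply_eq_of_fintype {X : Type*} [TopologicalSpace X] [AddCommGroup X]
    [IsTopologicalAddGroup X] [CompactSpace X] {ι : Type*} [Fintype ι]
    (γ : ι → X →ₜ+ UnitAddCircle) (a : ι → UnitAddCircle)
    (h : ∀ k : ι → ℤ, ∑ i, k i • γ i = 0 → ∑ i, k i • a i = 0) :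
    ∃ x, ∀ i, γ i x = a i := by
  borelize X
  let μ : Measure X := Measure.addHaarMeasure ⊤
  let m : C(X, UnitAddTorus ι) := ⟨fun x i => γ i x, by fun_prop⟩
  let m' : C(X, UnitAddTorus ι) := ⟨fun x i => γ i x - a i, by fun_prop⟩
  have hsum (k : ι → ℤ) (x : X) : ∑ i, k i • γ i x = (∑ i, k i • γ i) x := by
    let ev : (X →ₜ+ UnitAddCircle) →+ UnitAddCircle :=
      { toFun := fun γ => γ x, map_zero' := rfl, map_add' := fun _ _ => rfl }
    change ∑ i, k i • ev (γ i) = ev (∑ i, k i • γ i)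
    simp only [map_sum, map_zsmul]
  -- Both push-forwards of Haar measure have the same Fourier coefficients: if $\sum
  -- k_i\gamma_i\ne0$ both vanish, and otherwise `h` makes the shift by `a` invisible.
  have heq : integralAlong μ m = integralAlong μ m' := by
    refine ContinuousLinearMap.ext_on (s := Set.range UnitAddTorus.mFourier) ?_ ?_
    · rw [← Submodule.dense_iff_topologicalClosure_eq_top.symm]
      exact UnitAddTorus.span_mFourier_closure_eq_top
    · rintro _ ⟨k, rfl⟩
      rw [integralAlong_apply, integralAlong_apply]
      simp only [UnitAddTorus.mFourier_eq_toCircle, m, m', ContinuousMap.coe_mk, smul_sub,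
        Finset.sum_sub_distrib, hsum]
      by_cases hk : ∑ i, k i • γ i = 0
      · simp [h k hk]
      · have h0 := integral_circleFun_eq_zero μ _ hk
        have h1 : ∫ x, (AddCircle.toCircle ((∑ i, k i • γ i) x) : ℂ) ∂μ = 0 := h0
        simp only [sub_eq_add_neg, AddCircle.toCircle_add, Circle.coe_mul]
        rw [h1, integral_mul_const, h1, zero_mul]
  -- The distance to the range of `m'` has integral $0$ along `m'`, hence along `m`; so `m 0 = 0`
  -- lies in that compact range.
  let g : C(UnitAddTorus ι, ℂ) := ⟨fun z => (Metric.infDist z (Set.range m') : ℂ), by fun_prop⟩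
  have hg' : integralAlong μ m' g = 0 := by
    rw [integralAlong_apply]
    simp [g, Metric.infDist_zero_of_mem (Set.mem_range_self _)]
  rw [← heq, integralAlong_apply] at hg'
  simp only [g, ContinuousMap.coe_mk, integral_complex_ofReal] at hg'
  have hint : ∫ x, Metric.infDist (m x) (Set.range m') ∂μ = 0 := by exact_mod_cast hg'
  have h0 : Metric.infDist (m 0) (Set.range m') = 0 := by
    by_contra hne
    have hc : Continuous fun x => Metric.infDist (m x) (Set.range m') := by fun_prop
    exact (hc.integral_pos_of_hasCompactSupport_nonneg_nonzero (μ := μ)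
      (HasCompactSupport.of_compactSpace _) (fun y => Metric.infDist_nonneg) hne).ne' hint
  have hclosed : IsClosed (Set.range m') := (isCompact_range m'.continuous).isClosed
  obtain ⟨x, hx⟩ := (hclosed.mem_iff_infDist_zero (Set.range_nonempty _)).mpr h0
  refine ⟨x, fun i => ?_⟩
  have := congrFun hx i
  simpa [m, m', sub_eq_zero] using this

/-- Every homomorphism from a group of characters to the circle is evaluation at a point. -/
theorem exists_forall_apply_eq {X : Type*} [TopologicalSpace X] [AddCommGroup X]
    [IsTopologicalAddGroup X] [CompactSpace X] (S : AddSubgroup (X →ₜ+ UnitAddCircle))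
    (φ : S →+ UnitAddCircle) : ∃ x, ∀ γ : S, (γ : X →ₜ+ UnitAddCircle) x = φ γ := by
  have hc (γ : S) : IsClosed {x | (γ : X →ₜ+ UnitAddCircle) x = φ γ} :=
    isClosed_eq (by fun_prop) continuous_const
  -- Compactness reduces to finitely many characters, whose integer relations `φ` respects.
  obtain ⟨x, -, hx⟩ := isCompact_univ.inter_iInter_nonempty _ hc fun s => by
    obtain ⟨x, hx⟩ := exists_forall_apply_eq_of_fintype
      (fun γ : s => ((γ : S) : X →ₜ+ UnitAddCircle)) (fun γ => φ γ) fun k hk => by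
        have : ∑ i : s, k i • (i : S) = 0 := by
          ext1
          simpa using hk
        simpa using congrArg φ this
    exact ⟨x, trivial, Set.mem_iInter₂.mpr fun γ hγ => hx ⟨γ, hγ⟩⟩
  exact ⟨x, fun γ => Set.mem_iInter.mp hx γ⟩

end CompactGroups

/-! ### Fitting decomposition and local nilpotence of $A^*-1$ -/

/-- The forward orbit of `γ` under an endomorphism `B` eventually enters a `B`-invariant subgroup
on which `B` is injective. -/
theorem AddMonoidHom.exists_invariant_injective {M : Type*} [AddCommGroup M] (B : M →+ M) (γ : M) :
    ∃ (k : ℕ) (S : AddSubgroup M), B^[k] γ ∈ S ∧ (∀ s ∈ S, B s ∈ S) ∧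
      ∀ s ∈ S, B s = 0 → s = 0 := by
  let b : Module.End ℤ M := B.toIntLinearMap
  let e := Module.AEval'.of b
  have he (m : M) : (Polynomial.X : Polynomial ℤ) • e m = e (B m) := Module.AEval'.X_smul_of _ _
  let N : Submodule (Polynomial ℤ) (Module.AEval' b) := Submodule.span _ {e γ}
  have : IsNoetherian (Polynomial ℤ) N :=
    isNoetherian_span_of_finite _ (Set.finite_singleton _)
  let f : Module.End (Polynomial ℤ) N := LinearMap.lsmul _ _ Polynomial.X
  have hf (n : N) : f n = (Polynomial.X : Polynomial ℤ) • n := rfl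
  -- Let $X$ act as `B`: the cyclic $\mathbb Z[X]$-module of `γ` is Noetherian, so the kernel and
  -- range of `f ^ k` are eventually disjoint. The range is the required subgroup, and `1 ≤ k` puts
  -- the kernel of `f` inside that of `f ^ k`.
  obtain ⟨k, hk, hk1⟩ := (f.eventually_disjoint_ker_pow_range_pow.and
    (eventually_ge_atTop 1)).exists
  let R : Submodule (Polynomial ℤ) (Module.AEval' b) := (LinearMap.range (f ^ k)).map N.subtype
  refine ⟨k, R.toAddSubgroup.comap (e : M →+ Module.AEval' b), ?_, ?_, ?_⟩
  · change e (B^[k] γ) ∈ R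
    refine ⟨(f ^ k) ⟨e γ, Submodule.mem_span_singleton_self _⟩, ⟨_, rfl⟩, ?_⟩
    have (j : ℕ) : N.subtype ((f ^ j) ⟨e γ, Submodule.mem_span_singleton_self _⟩)
        = e (B^[j] γ) := by
      induction j with
      | zero => rfl
      | succ j ih =>
        rw [pow_succ', Module.End.mul_apply, hf, map_smul, ih, he, Function.iterate_succ_apply']
    exact this k
  · intro s hs
    change e (B s) ∈ R
    rw [← he]
    exact R.smul_mem _ hs
  · intro s hs h0
    obtain ⟨n, hn, hns⟩ := hs
    change N.subtype n = e s at hns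
    have hn0 : n ∈ LinearMap.ker (f ^ k) := by
      obtain ⟨j, rfl⟩ := Nat.exists_eq_add_of_le' hk1
      rw [LinearMap.mem_ker, pow_succ, Module.End.mul_apply]
      have : f n = 0 := by
        apply Subtype.ext
        change N.subtype (f n) = 0
        rw [hf, map_smul, hns, he, h0, map_zero]
      rw [this, map_zero]
    have := (Submodule.disjoint_def.mp hk) n hn0 hn
    rw [this, map_zero] at hns
    exact (map_eq_zero_iff e e.injective).mp hns.symm

namespace QuasiDiscrete

section Nilpotent

variable {X : Type*} [TopologicalSpace X] [AddCommGroup X]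

/-- The endomorphism `γ ↦ γ ∘ A - γ` of the character group. -/
noncomputable def dualSubOne (A : X →ₜ+ X) : (X →ₜ+ UnitAddCircle) →+ (X →ₜ+ UnitAddCircle) where
  toFun γ := γ.comp A - γ
  map_zero' := by ext x; simp
  map_add' γ δ := by
    have : (γ + δ).comp A = γ.comp A + δ.comp A := rfl
    rw [this]
    abel

theorem apply_map_eq (A : X →ₜ+ X) (γ : X →ₜ+ UnitAddCircle) (x : X) :
    γ (A x) = dualSubOne A γ x + γ x := by
  have : γ.comp A = dualSubOne A γ + γ := (sub_add_cancel _ _).symm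
  exact DFunLike.congr_fun this x

variable [IsTopologicalAddGroup X] [CompactSpace X]

/-- For a minimal affine map, a subgroup of characters on which `A* - 1` is injective is
trivial. -/
theorem eq_zero_of_injOn_of_isMinimalMap {T : C(X, X)} (hmin : IsMinimalMap T) {A : X →ₜ+ X}
    {a : X} (hT : ∀ x, T x = A x + a) {S : AddSubgroup (X →ₜ+ UnitAddCircle)}
    (hS : ∀ s ∈ S, dualSubOne A s ∈ S) (hinj : ∀ s ∈ S, dualSubOne A s = 0 → s = 0)
    {s : X →ₜ+ UnitAddCircle} (hs : s ∈ S) : s = 0 := by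
  let ψ : S →+ (X →ₜ+ UnitAddCircle) := (dualSubOne A).comp S.subtype
  have hψ : Function.Injective ψ := (injective_iff_map_eq_zero ψ).mpr fun s h =>
    Subtype.ext (hinj s s.2 h)
  let e := AddMonoidHom.ofInjective hψ
  let ev : S →+ UnitAddCircle :=
    { toFun := fun s => -(s : X →ₜ+ UnitAddCircle) a
      map_zero' := neg_zero
      map_add' := fun s t => neg_add _ _ }
  -- Injectivity makes $(A^*-1)s\mapsto -s(a)$ a well-defined homomorphism; a point realizing it
  -- satisfies $s(Tx)=s(x)$ on `S`.
  obtain ⟨x, hx⟩ := exists_forall_apply_eq ψ.range (ev.comp e.symm.toAddMonoidHom)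
  have hfix : ∀ s ∈ S, dualSubOne A s x = -s a := fun s hs => by
    have h := hx (e ⟨s, hs⟩)
    have h' : (ev.comp e.symm.toAddMonoidHom) (e ⟨s, hs⟩) = -s a := by
      change ev (e.symm (e ⟨s, hs⟩)) = _
      rw [e.symm_apply_apply]
      rfl
    exact h.trans h'
  have hconst : ∀ n : ℕ, ∀ s ∈ S, s (T^[n] x) = s x := fun n => by
    induction n with
    | zero => exact fun _ _ => rfl
    | succ n ih =>
      intro s hs
      rw [Function.iterate_succ_apply', hT, map_add, apply_map_eq, ih _ (hS s hs), ih s hs,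
        hfix s hs]
      abel
  have hall : (s : X → UnitAddCircle) = fun _ => s x :=
    Continuous.ext_on (hmin x) (by fun_prop) continuous_const
      (by rintro _ ⟨n, rfl⟩; exact hconst n s hs)
  ext y
  rw [congrFun hall y, ← congrFun hall 0, map_zero]
  rfl

theorem exists_iterate_dualSubOne_eq_zero {T : C(X, X)} (hmin : IsMinimalMap T) {A : X →ₜ+ X}
    {a : X} (hT : ∀ x, T x = A x + a) (γ : X →ₜ+ UnitAddCircle) :
    ∃ k, (dualSubOne A)^[k] γ = 0 := by
  obtain ⟨k, S, hk, hS, hinj⟩ := (dualSubOne A).exists_invariant_injective γ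
  exact ⟨k, eq_zero_of_injOn_of_isMinimalMap hmin hT hS hinj hk⟩

end Nilpotent

/-! ### The chain $G_n$ and discrete integration -/

section Quasi

variable {X : Type*} [TopologicalSpace X]

theorem one_mem_eigenvalues [Nonempty X] (T : C(X, X)) : (1 : ℂ) ∈ eigenvalues T :=
  ⟨1, one_ne_zero, by ext x; simp⟩

theorem const_mem_quasiEigenfunctions_one [Nonempty X] (T : C(X, X)) {z : ℂ} (hz : ‖z‖ = 1) :
    ContinuousMap.const X z ∈ quasiEigenfunctions T 1 :=
  ⟨fun _ => hz, _, ⟨1, one_mem_eigenvalues T, rfl⟩, by ext x; simp⟩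

/-- The chain is compared from rank $1$ on, since elements of $G_0$ are not assumed unimodular; an
eigenvalue of a unimodular function is. -/
theorem quasiEigenfunctions_subset_succ [Nonempty X] (T : C(X, X)) (n : ℕ) :
    quasiEigenfunctions T (n + 1) ⊆ quasiEigenfunctions T (n + 2) := by
  induction n with
  | zero =>
    rintro f ⟨hf, _, ⟨z, -, rfl⟩, hz⟩
    refine ⟨hf, _, const_mem_quasiEigenfunctions_one T (z := z) ?_, hz⟩
    obtain ⟨x⟩ := ‹Nonempty X›
    have := congrArg norm (DFunLike.congr_fun hz x)
    simpa [hf] using this.symm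
  | succ n ih =>
    rintro f ⟨hf, g, hg, h⟩
    exact ⟨hf, g, ih hg, h⟩

theorem quasiEigenfunctions_mono [Nonempty X] (T : C(X, X)) {m n : ℕ} (h : m ≤ n) :
    quasiEigenfunctions T (m + 1) ⊆ quasiEigenfunctions T (n + 1) :=
  monotone_nat_of_le_succ (f := fun n => quasiEigenfunctions T (n + 1))
    (quasiEigenfunctions_subset_succ T) h

/-- $G_{n+1}$ is determined by $G_n$, so one equality propagates up the chain. -/
theorem quasiEigenfunctions_eq_of_stable (T : C(X, X)) {n : ℕ}
    (h : quasiEigenfunctions T n = quasiEigenfunctions T (n + 1)) (m : ℕ) :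
    quasiEigenfunctions T (n + m) = quasiEigenfunctions T n := by
  have hs (j : ℕ) : quasiEigenfunctions T (n + j) = quasiEigenfunctions T (n + j + 1) := by
    induction j with
    | zero => exact h
    | succ j ih =>
      ext f
      change (_ ∧ ∃ g ∈ quasiEigenfunctions T (n + j), _) ↔
        (_ ∧ ∃ g ∈ quasiEigenfunctions T (n + j + 1), _)
      rw [ih]
  induction m with
  | zero => rfl
  | succ m ih => rw [← ih, hs m]; rfl

/-- The order of the chain of quasi-eigenfunctions. -/
noncomputable def quasiOrder (T : C(X, X)) : ℕ∞ :=
  sInf {m : ℕ∞ | ∃ n : ℕ, 1 ≤ n ∧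
      quasiEigenfunctions T n = quasiEigenfunctions T (n + 1) ∧ m = (n : ℕ∞)}

theorem one_le_quasiOrder (T : C(X, X)) : 1 ≤ quasiOrder T := by
  refine le_sInf ?_
  rintro _ ⟨n, hn, -, rfl⟩
  exact_mod_cast hn

/-- Each quasi-eigenfunction of positive rank has rank at most the order of the chain. -/
theorem exists_mem_quasiEigenfunctions_le_quasiOrder [Nonempty X] (T : C(X, X)) {k : ℕ}
    {f : C(X, ℂ)} (hf : f ∈ quasiEigenfunctions T (k + 1)) :
    ∃ m : ℕ, (m : ℕ∞) ≤ quasiOrder T ∧ f ∈ quasiEigenfunctions T m := by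
  rcases Set.eq_empty_or_nonempty {m : ℕ∞ | ∃ n : ℕ, 1 ≤ n ∧
      quasiEigenfunctions T n = quasiEigenfunctions T (n + 1) ∧ m = (n : ℕ∞)} with h | h
  -- The infimum of the empty set is `⊤`, so any rank is allowed.
  · exact ⟨k + 1, by simp [quasiOrder, h], hf⟩
  · obtain ⟨n, hn, hst, hm⟩ := csInf_mem h
    refine ⟨n, hm.ge, ?_⟩
    obtain ⟨n, rfl⟩ := Nat.exists_eq_add_of_le' hn
    rcases le_total k n with hkn | hkn
    · exact quasiEigenfunctions_mono T hkn hf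
    · obtain ⟨j, rfl⟩ := Nat.exists_eq_add_of_le hkn
      rw [← quasiEigenfunctions_eq_of_stable T hst j]
      convert hf using 2
      ring

/-- Faulhaber's formula, monomial by monomial: each summation costs one degree. -/
theorem exists_polynomial_eval_eq_sum_range (Q : Polynomial ℝ) :
    ∃ R : Polynomial ℝ, R.natDegree ≤ Q.natDegree + 1 ∧
      ∀ n : ℕ, R.eval (n : ℝ) = ∑ i ∈ Finset.range n, Q.eval (i : ℝ) := by
  have hmono (p : ℕ) : ∃ R : Polynomial ℝ, R.natDegree ≤ p + 1 ∧
      ∀ n : ℕ, R.eval (n : ℝ) = ∑ i ∈ Finset.range n, (i : ℝ) ^ p := by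
    refine ⟨∑ i ∈ Finset.range (p + 1), Polynomial.C (((bernoulli i * ((p + 1).choose i) / (p + 1)
      : ℚ)) : ℝ) * Polynomial.X ^ (p + 1 - i), ?_, fun n => ?_⟩
    · refine Polynomial.natDegree_sum_le_of_forall_le _ _ fun i _ => ?_
      exact (Polynomial.natDegree_C_mul_X_pow_le _ _).trans (Nat.sub_le _ _)
    · have h : ((∑ k ∈ Finset.range n, (k : ℚ) ^ p : ℚ) : ℝ) = _ :=
        congrArg _ (sum_range_pow n p)
      push_cast at h
      rw [h, Polynomial.eval_finsetSum]
      refine Finset.sum_congr rfl fun i _ => ?_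
      simp only [Polynomial.eval_mul, Polynomial.eval_C, Polynomial.eval_pow, Polynomial.eval_X]
      push_cast
      ring
  choose R hR hRe using hmono
  refine ⟨∑ p ∈ Finset.range (Q.natDegree + 1), Polynomial.C (Q.coeff p) * R p, ?_, fun n => ?_⟩
  · refine Polynomial.natDegree_sum_le_of_forall_le _ _ fun p hp => ?_
    refine (Polynomial.natDegree_C_mul_le _ _).trans ((hR p).trans ?_)
    have := Finset.mem_range.mp hp
    omega
  · rw [Polynomial.eval_finsetSum]
    simp only [Polynomial.eval_mul, Polynomial.eval_C, hRe, Finset.mul_sum]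
    rw [Finset.sum_comm]
    exact Finset.sum_congr rfl fun i _ => (Polynomial.eval_eq_sum_range _).symm

end Quasi

end QuasiDiscrete

namespace QuasiDiscrete

/-! ### Polynomial phases along orbits -/

section Orbit

variable {X : Type*} [TopologicalSpace X]

/-- A quasi-eigenfunction of rank `k` is polynomial of degree at most `k` along orbits. -/
theorem exists_polynomial_apply_iterate_eq (T : C(X, X)) (k : ℕ) {f : C(X, ℂ)}
    (hf : f ∈ quasiEigenfunctions T k) (hf1 : ∀ x, ‖f x‖ = 1) (x : X) :
    ∃ P : Polynomial ℝ, P.natDegree ≤ k ∧ ∀ n : ℕ, f (T^[n] x) =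
      Complex.exp (2 * (Real.pi : ℂ) * Complex.I * ((P.eval (n : ℝ) : ℝ) : ℂ)) := by
  have harg : ∀ z : ℂ, ‖z‖ = 1 → ∃ θ : ℝ,
      z = Complex.exp (2 * (Real.pi : ℂ) * Complex.I * (θ : ℂ)) := fun z hz => by
    refine ⟨z.arg / (2 * Real.pi), ?_⟩
    have h := Complex.norm_mul_exp_arg_mul_I z
    rw [hz, Complex.ofReal_one, one_mul] at h
    rw [← h]
    congr 1
    rw [h]
    have : (Real.pi : ℂ) ≠ 0 := by exact_mod_cast Real.pi_ne_zero
    push_cast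
    field_simp
  induction k generalizing f with
  | zero =>
    obtain ⟨z, -, rfl⟩ := hf
    obtain ⟨θ, hθ⟩ := harg z (by simpa using hf1 x)
    exact ⟨Polynomial.C θ, by simp, fun n => by simpa using hθ⟩
  | succ k ih =>
    obtain ⟨-, g, hg, hgf⟩ := hf
    have hgf' : ∀ y, f (T y) = g y * f y := fun y => DFunLike.congr_fun hgf y
    obtain ⟨Q, hQ, hQe⟩ := ih hg fun y => by
      have := congrArg norm (hgf' y)
      simpa [hf1] using this.symm
    obtain ⟨θ, hθ⟩ := harg (f x) (hf1 x)
    obtain ⟨R, hR, hRe⟩ := exists_polynomial_eval_eq_sum_range Q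
    -- $f(T^nx)=f(x)\prod_{i<n}g(T^ix)$, so the phase of $f$ is $\theta+\sum_{i<n}Q(i)$.
    refine ⟨R + Polynomial.C θ, ?_, fun n => ?_⟩
    · rw [Polynomial.natDegree_add_C]
      omega
    · simp only [Polynomial.eval_add, Polynomial.eval_C, hRe]
      induction n with
      | zero => simpa using hθ
      | succ n ihn =>
        rw [Function.iterate_succ_apply', hgf', ihn, hQe, ← Complex.exp_add,
          Finset.sum_range_succ]
        congr 1
        push_cast
        ring

end Orbit

section Affine

variable {X : Type*} [TopologicalSpace X] [AddCommGroup X]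

/-- Composing $e^{2\pi i\gamma}$ with $T$ multiplies it by $e^{2\pi i\gamma(a)}e^{2\pi
i(A^*-1)\gamma}$. The free scalar `z` lets the induction absorb the constant. -/
theorem smul_circleFun_mem_quasiEigenfunctions {T : C(X, X)} {A : X →ₜ+ X} {a : X}
    (hT : ∀ x, T x = A x + a) (k : ℕ) {γ : X →ₜ+ UnitAddCircle}
    (hγ : (dualSubOne A)^[k] γ = 0) {z : ℂ} (hz : ‖z‖ = 1) :
    z • circleFun (γ : C(X, UnitAddCircle)) ∈ quasiEigenfunctions T (k + 1) := by
  induction k generalizing γ z with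
  | zero =>
    obtain rfl : γ = 0 := hγ
    convert const_mem_quasiEigenfunctions_one T hz
    ext x
    simp [circleFun_apply]
  | succ k ih =>
    refine ⟨fun x => by simp [norm_circleFun, hz], _,
      ih (γ := dualSubOne A γ) hγ (z := (AddCircle.toCircle (γ a) : ℂ)) (Circle.norm_coe _), ?_⟩
    ext x
    have h : γ (T x) = dualSubOne A γ x + γ x + γ a := by rw [hT, map_add, apply_map_eq]
    simp only [ContinuousMap.comp_apply, ContinuousMap.smul_apply, ContinuousMap.mul_apply,
      circleFun_apply, ContinuousMap.coe_coe, h, AddCircle.toCircle_add, Circle.coe_mul,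
      smul_eq_mul]
    ring

/-- A character of `X ^ ℓ` is a product of characters of the factors. -/
theorem exists_circleFun_pi_eq_prod {ℓ : ℕ} (γ : (Fin ℓ → X) →ₜ+ UnitAddCircle) :
    ∃ δ : Fin ℓ → X →ₜ+ UnitAddCircle, ∀ y : Fin ℓ → X,
      circleFun (γ : C(Fin ℓ → X, UnitAddCircle)) y =
        ∏ j, circleFun (δ j : C(X, UnitAddCircle)) (y j) := by
  refine ⟨fun j => ⟨(γ : (Fin ℓ → X) →+ UnitAddCircle).comp (AddMonoidHom.single (fun _ => X) j),
    (map_continuous γ).comp (continuous_single (A := fun _ => X) j)⟩, fun y => ?_⟩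
  have htoCircle (s : Finset (Fin ℓ)) (u : Fin ℓ → UnitAddCircle) :
      (AddCircle.toCircle (∑ j ∈ s, u j) : ℂ) = ∏ j ∈ s, (AddCircle.toCircle (u j) : ℂ) := by
    induction s using Finset.induction_on with
    | empty => simp
    | insert i s hi ih =>
      rw [Finset.prod_insert hi, Finset.sum_insert hi, AddCircle.toCircle_add, Circle.coe_mul, ih]
  have hy : γ y = ∑ j, γ (Pi.single j (y j)) := by
    rw [← map_sum, Finset.univ_sum_single]
  rw [circleFun_apply, ContinuousMap.coe_coe, hy, htoCircle]
  rfl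

variable [IsTopologicalAddGroup X] [CompactSpace X]

theorem exists_circleFun_mem_quasiEigenfunctions {T : C(X, X)} (hT : IsAffineMap T)
    (hmin : IsMinimalMap T) (γ : X →ₜ+ UnitAddCircle) :
    ∃ k, circleFun (γ : C(X, UnitAddCircle)) ∈ quasiEigenfunctions T (k + 1) := by
  obtain ⟨A, a, hT⟩ := hT
  obtain ⟨k, hk⟩ := exists_iterate_dualSubOne_eq_zero hmin hT γ
  exact ⟨k, by simpa using smul_circleFun_mem_quasiEigenfunctions hT k hk (z := 1) (by simp)⟩

theorem hasQuasiDiscreteSpectrum_of_isMinimalMap [T2Space X] {T : C(X, X)} (hT : IsAffineMap T)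
    (hmin : IsMinimalMap T) : HasQuasiDiscreteSpectrum T := by
  have hd := Submodule.dense_iff_topologicalClosure_eq_top.mpr (dense_span_circleFun X)
  suffices hle : Submodule.span ℂ (Set.range fun γ : X →ₜ+ UnitAddCircle =>
      circleFun (γ : C(X, UnitAddCircle))) ≤
      (Algebra.adjoin ℂ (⋃ n, quasiEigenfunctions T (n + 1))).toSubmodule from hd.mono hle
  rw [Submodule.span_le]
  rintro _ ⟨γ, rfl⟩
  obtain ⟨k, hk⟩ := exists_circleFun_mem_quasiEigenfunctions hT hmin γ
  exact Algebra.subset_adjoin (Set.mem_iUnion.mpr ⟨k, hk⟩)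

/-- Along orbits, characters are polynomial of degree at most the order of the system. -/
theorem exists_polynomial_circleFun_iterate_eq {T : C(X, X)} (hT : IsAffineMap T)
    (hmin : IsMinimalMap T) (γ : X →ₜ+ UnitAddCircle) (x : X) :
    ∃ P : Polynomial ℝ, (P.natDegree : ℕ∞) ≤ quasiOrder T ∧ ∀ n : ℕ,
      circleFun (γ : C(X, UnitAddCircle)) (T^[n] x) =
      Complex.exp (2 * (Real.pi : ℂ) * Complex.I * ((P.eval (n : ℝ) : ℝ) : ℂ)) := by
  obtain ⟨k, hk⟩ := exists_circleFun_mem_quasiEigenfunctions hT hmin γ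
  obtain ⟨m, hm, hmem⟩ := exists_mem_quasiEigenfunctions_le_quasiOrder T hk
  obtain ⟨P, hP, hPe⟩ := exists_polynomial_apply_iterate_eq T m hmem (fun y =>
    norm_circleFun _ y) x
  exact ⟨P, (Nat.cast_le.mpr hP).trans hm, hPe⟩

end Affine

/-! ### Weighted averages and the conclusion -/

section Averages

/-- Weighted averages with weights of bounded means vanish on all of `C(Y)` as soon as they vanish
on a set with dense span. -/
theorem tendsto_weighted_average_of_span {Y : Type*} [TopologicalSpace Y] [CompactSpace Y]
    {c : ℕ → ℂ} {C : ℝ} (hc : ∀ᶠ N : ℕ in atTop, ∑ n ∈ Finset.range N, ‖c n‖ ≤ C * N) (y : ℕ → Y)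
    {S : Set C(Y, ℂ)} (hS : (Submodule.span ℂ S).topologicalClosure = ⊤)
    (h : ∀ F ∈ S, Tendsto (fun N : ℕ => (1 / (N : ℂ)) * ∑ n ∈ Finset.range N, c n * F (y n))
      atTop (𝓝 0)) (F : C(Y, ℂ)) :
    Tendsto (fun N : ℕ => (1 / (N : ℂ)) * ∑ n ∈ Finset.range N, c n * F (y n))
      atTop (𝓝 0) := by
  have hspan : ∀ G ∈ Submodule.span ℂ S, Tendsto
      (fun N : ℕ => (1 / (N : ℂ)) * ∑ n ∈ Finset.range N, c n * G (y n)) atTop (𝓝 0) := by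
    intro G hG
    induction hG using Submodule.span_induction with
    | mem G hG => exact h G hG
    | zero => simp
    | add G H _ _ hG hH =>
      simpa [mul_add, Finset.sum_add_distrib] using hG.add hH
    | smul a G _ hG =>
      have := hG.const_mul a
      rw [mul_zero] at this
      refine this.congr fun N => ?_
      simp only [ContinuousMap.smul_apply, smul_eq_mul, Finset.mul_sum]
      exact Finset.sum_congr rfl fun n _ => by ring
  have hd := Submodule.dense_iff_topologicalClosure_eq_top.mpr hS
  rw [Metric.tendsto_nhds]
  intro ε hε
  -- `|C| + 1` keeps the radius positive whatever the sign of `C`, and makes the error at most `ε /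
  -- 2`.
  obtain ⟨G, hG, hFG⟩ := Metric.dense_iff.mp hd F (ε / (2 * (|C| + 1))) (by positivity)
  rw [Metric.mem_ball, dist_comm, dist_eq_norm] at hG
  filter_upwards [hc, eventually_ge_atTop 1,
    Metric.tendsto_nhds.mp (hspan G hFG) (ε / 2) (half_pos hε)] with N hN hN1 hGN
  rw [dist_zero_right] at hGN ⊢
  have hN0 : (0 : ℝ) < N := by exact_mod_cast hN1
  have hsplit : (1 / (N : ℂ)) * ∑ n ∈ Finset.range N, c n * F (y n) =
      (1 / (N : ℂ)) * ∑ n ∈ Finset.range N, c n * G (y n) +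
      (1 / (N : ℂ)) * ∑ n ∈ Finset.range N, c n * (F - G) (y n) := by
    rw [← mul_add, ← Finset.sum_add_distrib]
    congr 1
    exact Finset.sum_congr rfl fun n _ => by rw [ContinuousMap.sub_apply]; ring
  have hsum : ‖∑ n ∈ Finset.range N, c n * (F - G) (y n)‖ ≤ C * N * ‖F - G‖ := by
    refine (norm_sum_le _ _).trans (le_trans ?_
      (mul_le_mul_of_nonneg_right hN (norm_nonneg (F - G))))
    rw [Finset.sum_mul]
    refine Finset.sum_le_sum fun n _ => ?_
    rw [norm_mul]
    gcongr
    exact (F - G).norm_coe_le_norm _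
  have hrest : ‖(1 / (N : ℂ)) * ∑ n ∈ Finset.range N, c n * (F - G) (y n)‖ ≤ C * ‖F - G‖ := by
    rw [norm_mul, norm_div, norm_one, Complex.norm_natCast, one_div, inv_mul_le_iff₀ hN0]
    linarith
  have hsmall : C * ‖F - G‖ ≤ ε / 2 := by
    have h1 : C * ‖F - G‖ ≤ (|C| + 1) * (ε / (2 * (|C| + 1))) := by
      have := le_abs_self C
      gcongr
      linarith
    refine h1.trans (le_of_eq ?_)
    field_simp
  rw [hsplit]
  refine (norm_add_le _ _).trans_lt ?_
  linarith

theorem eventually_sum_range_norm_le {c : ℕ → ℂ}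
    (hc : (fun N : ℕ => ∑ n ∈ Finset.Icc 1 N, ‖c n‖) =O[atTop] (fun N : ℕ => (N : ℝ))) :
    ∃ C : ℝ, ∀ᶠ N : ℕ in atTop, ∑ n ∈ Finset.range N, ‖c n‖ ≤ C * N := by
  obtain ⟨C, hC⟩ := hc.bound
  -- The hypothesis sums from $1$, the averages from $0$; the extra term is at most `‖c 0‖ * N` once
  -- `1 ≤ N`.
  refine ⟨‖c 0‖ + C, ?_⟩
  filter_upwards [hC, eventually_ge_atTop 1] with N hN hN1
  have h1 : ∑ n ∈ Finset.Icc 1 N, ‖c n‖ ≤ C * N := by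
    simpa using (le_abs_self _).trans hN
  have h2 : ∑ n ∈ Finset.range N, ‖c n‖ ≤ ∑ n ∈ insert 0 (Finset.Icc 1 N), ‖c n‖ := by
    refine Finset.sum_le_sum_of_subset_of_nonneg (fun n hn => ?_) fun _ _ _ => norm_nonneg _
    simp only [Finset.mem_range, Finset.mem_insert, Finset.mem_Icc] at hn ⊢
    omega
  rw [Finset.sum_insert (by simp)] at h2
  have h3 : (1 : ℝ) ≤ N := by exact_mod_cast hN1
  nlinarith [norm_nonneg (c 0)]

end Averages

end QuasiDiscrete

theorem corollary1 {X : Type*} [TopologicalSpace X] [AddCommGroup X] [IsTopologicalAddGroup X]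
    [CompactSpace X] [T2Space X] [ConnectedSpace X]
    (T : C(X, X)) (hT : QuasiDiscrete.IsAffineMap T) (hmin : QuasiDiscrete.IsMinimalMap T) :
    ∃ d : ℕ∞, 1 ≤ d ∧ QuasiDiscrete.HasQuasiDiscreteSpectrumOfOrder T d ∧
      ∀ (ℓ : ℕ), 1 ≤ ℓ →
      ∀ (q : Fin ℓ → Polynomial ℚ) (r : Fin ℓ → ℕ → ℕ),
        (∀ (j : Fin ℓ) (n : ℕ), (q j).eval (n : ℚ) = (r j n : ℚ)) →
      ∀ (Δ : ℕ), Δ = Finset.univ.sup (fun j : Fin ℓ => (q j).natDegree) →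
      ∀ (c : ℕ → ℂ), QuasiDiscrete.IsOscillating c (d * (Δ : ℕ∞)) →
        (fun N : ℕ => ∑ n ∈ Finset.Icc 1 N, ‖c n‖) =O[atTop] (fun N : ℕ => (N : ℝ)) →
      ∀ (F : C(Fin ℓ → X, ℂ)) (x : X),
        Tendsto (fun N : ℕ => (1 / (N : ℂ)) * ∑ n ∈ Finset.range N,
            c n * F (fun j : Fin ℓ => T^[r j n] x))
          atTop (𝓝 0) := by
  refine ⟨QuasiDiscrete.quasiOrder T, QuasiDiscrete.one_le_quasiOrder T,
    ⟨QuasiDiscrete.hasQuasiDiscreteSpectrum_of_isMinimalMap hT hmin, rfl⟩, ?_⟩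
  intro ℓ _ q r hqr Δ hΔ c hc hO F x
  obtain ⟨C, hC⟩ := QuasiDiscrete.eventually_sum_range_norm_le hO
  refine QuasiDiscrete.tendsto_weighted_average_of_span hC (fun n j => T^[r j n] x)
    (dense_span_circleFun (Fin ℓ → X)) ?_ F
  rintro _ ⟨γ, rfl⟩
  obtain ⟨δ, hδ⟩ := QuasiDiscrete.exists_circleFun_pi_eq_prod γ
  choose P hPd hP using fun j =>
    QuasiDiscrete.exists_polynomial_circleFun_iterate_eq hT hmin (δ j) x
  have hdeg (j : Fin ℓ) : ((((P j).comp ((q j).map (algebraMap ℚ ℝ))).natDegree : ℕ) : ℕ∞) ≤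
      QuasiDiscrete.quasiOrder T * (Δ : ℕ∞) := by
    rw [Polynomial.natDegree_comp, Polynomial.natDegree_map, Nat.cast_mul]
    -- The product is taken in `ℕ∞`, where `⊤ * 0 = 0`: if all `q j` are constant, so are the
    -- phases.
    refine mul_le_mul' (hPd j) (Nat.cast_le.mpr ?_)
    rw [hΔ]
    exact Finset.le_sup (f := fun j => (q j).natDegree) (Finset.mem_univ j)
  refine (hc (∑ j, (P j).comp ((q j).map (algebraMap ℚ ℝ))) ?_).congr fun N => ?_
  -- The degree bound for a sum takes a natural number, so an infinite bound is treated separately.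
  · rcases eq_or_ne (QuasiDiscrete.quasiOrder T * (Δ : ℕ∞)) ⊤ with h | h
    · rw [h]
      exact le_top
    · obtain ⟨K, hK⟩ := ENat.ne_top_iff_exists.mp h
      rw [← hK]
      refine Nat.cast_le.mpr (Polynomial.natDegree_sum_le_of_forall_le _ _ fun j _ => ?_)
      exact Nat.cast_le.mp ((hdeg j).trans hK.ge)
  · congr 1
    refine Finset.sum_congr rfl fun n _ => ?_
    congr 1
    have hr (j : Fin ℓ) : ((q j).map (algebraMap ℚ ℝ)).eval (n : ℝ) = (r j n : ℝ) := by
      have := congrArg (algebraMap ℚ ℝ) (hqr j n)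
      simpa [Polynomial.eval_map_algebraMap, Polynomial.aeval_def, Polynomial.eval₂_at_natCast]
        using this
    rw [hδ]
    simp only [hP, ← Complex.exp_sum, ← Finset.mul_sum, Polynomial.eval_finsetSum,
      Polynomial.eval_comp, hr]
    push_cast
    rfl
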